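/- Let $\Omega\subset\mathbb R^2$ be a piecewise $C^3$ domain: a bounded connected open set for which there is a finite set $\{x_1,\dots,x_J\}\subset\partial\Omega$ such that $\partial\Omega$ is $C^3$ regular in a neighbourhood of every point of $\partial\Omega\setminus\{x_1,\dots,x_J\}$, and there are pairwise disjoint open neighbourhoods $V_j$ of $x_j$ and $C^3$-diffeomorphisms $\phi_j:V_j\to(-1,1)^2$ with $\phi_j(x_j)=(0,0)$ and $\phi_j(V_j\cap\Omega)=(0,1)^2$. Let $HB(\Omega)$ be the space of functions $u\in W^{1,1}(\Omega)$ whose distributional second derivative $D^2u$ is a finite matrix-valued Radon measure on $\Omega$. For $u\in HB(\Omega)$ let $|D^2u|(\Omega)$ be the total variation of $D^2u$, $$|D^2u|(\Omega)=\sup\Big\{\int_\Omega u\sum_{i,j}\frac{\partial^2\varphi_{ij}}{\partial x_i\partial x_j}\,dx\ :\ \varphi\in C_c^\infty(\Omega;\mathbb R^{2\times2}_{\mathrm{sym}}),\ |\varphi(x)|_F\le1\ \text{for all }x\in\Omega\Big\},$$ where $|\cdot|_F$ is the Frobenius norm, and for $u,v\in HB(\Omega)$ let $$d(u,v)=\|u-v\|_{L^1(\Omega)}+\big||D^2u|(\Omega)-|D^2v|(\Omega)\big|.$$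 The weak topology of $HB(\Omega)$ is the topology generated by the norm $\|u\|_{W^{1,1}}=\|u\|_1+\|\nabla u\|_1$ and the seminorms $u\mapsto\big|\int_\Omega\psi\,d(D^2u)_{ij}\big|$, $\psi\in C_c^\infty(\Omega)$, $1\le i,j\le2$. Let $u\in HB(\Omega)$ and let $(u_n)_{n\in\mathbb N}$ be a sequence in $HB(\Omega)$ with $\lim_{n\to\infty}d(u,u_n)=0$. Then $u_n\to u$ in the weak topology of $HB(\Omega)$. In particular $\nabla u_n\to\nabla u$ in $L^1(\Omega;\mathbb R^2)$, and moreover $D^2u_n\rightharpoonup D^2u$ weakly-* as measures, that is, $\int_\Omega\psi\,d(D^2u_n)_{ij}\to\int_\Omega\psi\,d(D^2u)_{ij}$ for all $\psi\in C_0(\Omega)$ and $1\le i,j\le2$, where $C_0(\Omega)$ is the space of continuous functions on $\Omega$ that vanish at $\partial\Omega$. -/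

import Mathlib

open MeasureTheory Filter Topology Set
open scoped ENNReal ContDiff ZeroAtInfty

namespace BoundedHessian

/-- The Euclidean plane `ℝ²`. -/
abbrev Plane : Type := EuclideanSpace ℝ (Fin 2)

/-! ### Piecewise `C³` domains -/

/-- The open square `(-1,1)²`. -/
def square : Set Plane := {y | ∀ i, y i ∈ Ioo (-1 : ℝ) 1}

/-- `e` is a `C³`-diffeomorphism from the open set `e.source` onto `(-1,1)²`. -/
def IsC3Chart (e : OpenPartialHomeomorph Plane Plane) : Prop :=
  e.target = square ∧ ContDiffOn ℝ 3 e e.source ∧ ContDiffOn ℝ 3 e.symm e.target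

/-- The boundary of `Ω` is `C³` regular near `x`: a `C³`-diffeomorphism from a neighbourhood of `x`
onto `(-1,1)²` maps `x` to the origin and `Ω` to the half square `(-1,1) × (0,1)`. -/
def IsC3BoundaryPoint (Ω : Set Plane) (x : Plane) : Prop :=
  ∃ e : OpenPartialHomeomorph Plane Plane, IsC3Chart e ∧ x ∈ e.source ∧ e x = 0 ∧
    e '' (e.source ∩ Ω) = {y | y ∈ square ∧ 0 < y 1}

/-- Piecewise `C³` domain: a bounded connected open set whose boundary is `C³` regular except at
finitely many corners; near the corners, in pairwise disjoint neighbourhoods, a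
`C³`-diffeomorphism onto `(-1,1)²` maps the corner to the origin and `Ω` to `(0,1)²`. -/
structure IsPiecewiseC3Domain (Ω : Set Plane) : Prop where
  isOpen : IsOpen Ω
  isConnected : IsConnected Ω
  isBounded : Bornology.IsBounded Ω
  boundary : ∃ S : Finset Plane, (S : Set Plane) ⊆ frontier Ω ∧
    (∀ x ∈ frontier Ω, x ∉ S → IsC3BoundaryPoint Ω x) ∧
    ∃ e : Plane → OpenPartialHomeomorph Plane Plane,
      (∀ p ∈ S, IsC3Chart (e p) ∧ p ∈ (e p).source ∧ e p p = 0 ∧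
        e p '' ((e p).source ∩ Ω) = {y | y ∈ square ∧ 0 < y 0 ∧ 0 < y 1}) ∧
      (S : Set Plane).PairwiseDisjoint (fun p => (e p).source)

/-! ### Test functions and distributional derivatives -/

/-- `ψ ∈ C_c^∞(Ω)`. -/
def IsTestFunction (Ω : Set Plane) (ψ : Plane → ℝ) : Prop :=
  ContDiff ℝ ∞ ψ ∧ HasCompactSupport ψ ∧ tsupport ψ ⊆ Ω

/-- The classical partial derivative `∂ψ/∂xᵢ`. -/
noncomputable def pderiv (i : Fin 2) (ψ : Plane → ℝ) (x : Plane) : ℝ :=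
  fderiv ℝ ψ x (EuclideanSpace.single i 1)

/-- The space `L¹(Ω; F)` with respect to Lebesgue measure. -/
abbrev L1 (Ω : Set Plane) (F : Type) [NormedAddCommGroup F] : Type :=
  Lp F 1 ((volume : Measure Plane).restrict Ω)

/-- `g` is the distributional gradient of `u` on `Ω`. -/
def HasWeakGradient (Ω : Set Plane) (u : L1 Ω ℝ) (g : L1 Ω Plane) : Prop :=
  ∀ ψ, IsTestFunction Ω ψ → ∀ i,
    ∫ x in Ω, u x * pderiv i ψ x = - ∫ x in Ω, g x i * ψ x

/-- The finite matrix-valued Borel (hence Radon) measure with entries `μ i j` is the distributional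
second derivative of `u` on `Ω`. -/
def HasHessianMeasure (Ω : Set Plane) (u : L1 Ω ℝ) (μ : Fin 2 → Fin 2 → SignedMeasure Ω) : Prop :=
  ∀ ψ, IsTestFunction Ω ψ → ∀ i j,
    ∫ x in Ω, u x * pderiv i (pderiv j ψ) x = ∫ᵛ x : Ω, ψ x ∂•(μ i j)

/-! ### Functions of bounded Hessian -/

/-- The space `HB(Ω)` of functions in `W^{1,1}(Ω)` whose second distributional derivative is a
finite matrix-valued Radon measure on `Ω`. -/
def HB (Ω : Set Plane) : Type :=
  {u : L1 Ω ℝ // (∃ g, HasWeakGradient Ω u g) ∧ ∃ μ, HasHessianMeasure Ω u μ}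

namespace HB

variable {Ω : Set Plane}

/-- `u` as an element of `L¹(Ω)`. -/
def toL1 (u : HB Ω) : L1 Ω ℝ := u.1

/-- The gradient `∇u ∈ L¹(Ω; ℝ²)`. -/
noncomputable def grad (u : HB Ω) : L1 Ω Plane := u.2.1.choose

theorem hasWeakGradient_grad (u : HB Ω) : HasWeakGradient Ω u.toL1 u.grad := u.2.1.choose_spec

/-- The entries of the measure `D²u`. -/
noncomputable def hess (u : HB Ω) : Fin 2 → Fin 2 → SignedMeasure Ω := u.2.2.choose

theorem hasHessianMeasure_hess (u : HB Ω) : HasHessianMeasure Ω u.toL1 u.hess :=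
  u.2.2.choose_spec

end HB

/-! ### The total variation of the second derivative -/

/-- The fields `φ ∈ C_c^∞(Ω, S)`, with `S` the symmetric `2 × 2` matrices, whose Frobenius norm is
pointwise at most `1` on `Ω`. -/
def IsAdmissible (Ω : Set Plane) (φ : Plane → Matrix (Fin 2) (Fin 2) ℝ) : Prop :=
  (∀ i j, IsTestFunction Ω (fun x => φ x i j)) ∧ (∀ x, (φ x).IsSymm) ∧
    ∀ x ∈ Ω, √(∑ i, ∑ j, φ x i j ^ 2) ≤ 1

/-- `div div φ = ∑ᵢⱼ ∂²φᵢⱼ/∂xᵢ∂xⱼ`. -/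
noncomputable def divDiv (φ : Plane → Matrix (Fin 2) (Fin 2) ℝ) (x : Plane) : ℝ :=
  ∑ i, ∑ j, pderiv i (pderiv j (fun y => φ y i j)) x

/-- `|D²u|(Ω) ∈ [0,∞]`, the supremum of `∫_Ω u div div φ` over the admissible fields `φ`. -/
noncomputable def hessVariation (Ω : Set Plane) (u : L1 Ω ℝ) : ℝ≥0∞ :=
  ⨆ (φ : Plane → Matrix (Fin 2) (Fin 2) ℝ) (_ : IsAdmissible Ω φ),
    ENNReal.ofReal (∫ x in Ω, u x * divDiv φ x)

theorem pderiv_contDiff {ψ : Plane → ℝ} (h : ContDiff ℝ ∞ ψ) (i : Fin 2) :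
    ContDiff ℝ ∞ (pderiv i ψ) :=
  (h.fderiv_right (m := ∞) (by simp)).clm_apply contDiff_const

theorem pderiv_hasCompactSupport {ψ : Plane → ℝ} (h : HasCompactSupport ψ) (i : Fin 2) :
    HasCompactSupport (pderiv i ψ) :=
  h.fderiv_apply (𝕜 := ℝ) _

/-- `|D²u|(Ω)` is finite for `u ∈ HB(Ω)`, so that its conversion to a real number is harmless. -/
theorem HB.hessVariation_ne_top {Ω : Set Plane} (u : HB Ω) :
    hessVariation Ω u.toL1 ≠ ⊤ := by
  have hfin : ∀ i j, IsFiniteMeasure (u.hess i j).variation := fun i j => by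
    rw [← SignedMeasure.totalVariation_eq_variation]
    unfold SignedMeasure.totalVariation
    infer_instance
  have key : hessVariation Ω u.toL1 ≤
      ENNReal.ofReal (∑ i, ∑ j, (u.hess i j).variation.real univ) := by
    refine iSup₂_le fun φ hφ => ENNReal.ofReal_le_ofReal ?_
    have hint : ∀ i j, Integrable
        (fun x => u.toL1 x * pderiv i (pderiv j (fun y => φ y i j)) x) (volume.restrict Ω) := by
      intro i j
      have h1 := hφ.1 i j
      have hc := (pderiv_contDiff (pderiv_contDiff h1.1 j) i).continuous
      have hs := pderiv_hasCompactSupport (pderiv_hasCompactSupport h1.2.1 j) i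
      obtain ⟨C, hC⟩ := hc.bounded_above_of_compact_support hs
      exact (L1.integrable_coeFn u.toL1).mul_bdd hc.aestronglyMeasurable (ae_of_all _ hC)
    have e1 : ∫ x in Ω, u.toL1 x * divDiv φ x =
        ∑ i, ∑ j, ∫ᵛ x : Ω, φ x i j ∂•(u.hess i j) := by
      simp only [divDiv, Finset.mul_sum]
      rw [integral_finsetSum _ fun i _ => integrable_finsetSum _ fun j _ => hint i j]
      refine Finset.sum_congr rfl fun i _ => ?_
      rw [integral_finsetSum _ fun j _ => hint i j]
      exact Finset.sum_congr rfl fun j _ => u.hasHessianMeasure_hess _ (hφ.1 i j) i j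
    rw [e1]
    refine Finset.sum_le_sum fun i _ => Finset.sum_le_sum fun j _ => ?_
    refine (le_abs_self _).trans ?_
    have hb : ∀ x : Ω, ‖φ x i j‖ ≤ 1 := by
      intro x
      have h2 := hφ.2.2 x x.2
      rw [Real.sqrt_le_left (by norm_num), one_pow] at h2
      have h3 : φ x i j ^ 2 ≤ ∑ i, ∑ j, φ x i j ^ 2 :=
        (Finset.single_le_sum (f := fun j => φ x i j ^ 2) (fun _ _ => sq_nonneg _)
          (Finset.mem_univ j)).trans
        (Finset.single_le_sum (f := fun i => ∑ j, φ x i j ^ 2)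
          (fun _ _ => Finset.sum_nonneg fun _ _ => sq_nonneg _) (Finset.mem_univ i))
      exact (sq_le_one_iff_abs_le_one _).1 (h3.trans h2)
    have := VectorMeasure.norm_integral_le_of_norm_le_const (μ := u.hess i j)
      (B := ContinuousLinearMap.lsmul ℝ ℝ) (ae_of_all _ hb)
    simpa using this
  exact ne_top_of_le_ne_top ENNReal.ofReal_ne_top key

/-! ### The intermediate distance and the weak topology -/

namespace HB

variable {Ω : Set Plane}

/-- The distance `d(u,v) = ‖u - v‖₁ + | |D²u|(Ω) - |D²v|(Ω) |` of the intermediate topology. -/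
noncomputable def intermediateDist (u v : HB Ω) : ℝ :=
  ‖u.toL1 - v.toL1‖ +
    |(hessVariation Ω u.toL1).toReal - (hessVariation Ω v.toL1).toReal|

/-- The maps whose (semi)norms generate the weak topology: `u` and `∇u` in `L¹`, and
`∫_Ω ψ d(D²u)ᵢⱼ` for `ψ ∈ C_c^∞(Ω)` and `i, j ∈ {1, 2}`. -/
noncomputable def weakEmbedding (Ω : Set Plane) (u : HB Ω) :
    L1 Ω ℝ × L1 Ω Plane × ({ψ : Plane → ℝ // IsTestFunction Ω ψ} × Fin 2 × Fin 2 → ℝ) :=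
  (u.toL1, u.grad, fun p => ∫ᵛ x : Ω, p.1.1 x ∂•(u.hess p.2.1 p.2.2))

/-- The weak topology of `HB(Ω)`: the topology generated by the norm `‖u‖₁ + ‖∇u‖₁` of `W^{1,1}`
and the seminorms `|∫_Ω ψ d(D²u)ᵢⱼ|` with `ψ ∈ C_c^∞(Ω)`. -/
noncomputable abbrev weakTopology (Ω : Set Plane) : TopologicalSpace (HB Ω) :=
  TopologicalSpace.induced (weakEmbedding Ω) inferInstance

end HB

end BoundedHessian

namespace BoundedHessian

/-! ### Weighted averages along a segment -/

/-! Only two consequences of `d(u, v n) → 0` are needed: convergence in `L¹`, and boundedness of the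
total variations of `D²(v n)`. The gradients converge by interpolation between these two.

For smooth `w`, Taylor's formula reads `∂ₑw(x) = w(x + e) - w(x) - ∫₀¹ (1 - s) ∂ₑ∂ₑw(x + s e) ds`.
If the segments `x + [0,1] e` with `x ∈ A` stay in `Ω`, the `L¹(A)` norm of `∂ₑw` is therefore at
most `‖e‖² |D²w|(Ω) + 2‖w‖₁`. To avoid smoothing `u`, the formula is transferred to test functions:
`exists_second_primitive` writes `∂ₑη = ∂ₑ∂ₑζ + (η - η(· - e))` with `ζ` a weighted average of
translates of `η`. Duality then gives `integral_abs_inner_grad_sub_le`. Replacing `e` by `h e` and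
dividing by `h` leaves the bound `C h + 2‖u - v n‖₁ / h`, which is made small by fixing a small `h`
and then letting `n → ∞`.

The regularity of the boundary enters only through an interior cone condition
(`IsPiecewiseC3Domain.hasInteriorCone`): near each point of the closure an open ball of directions
points into `Ω`. Such a ball contains enough directions to recover the full gradient, and
compactness of the closure makes the local convergence global.

The Hessian measures converge on test functions because `u` converges in `L¹`. The bound on the
variations extends this to `C₀(Ω)` by density. -/

/-- The measure `(1 - s) ds` on `(0,1]`. -/
noncomputable def taperMeasure : Measure ℝ :=
  (volume.restrict (Ioc 0 1)).withDensity fun s => ENNReal.ofReal (1 - s)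

/-- The exact mass is `1/2`; the crude bound suffices, since constants play no role in the limit. -/
theorem taperMeasure_univ_le : taperMeasure univ ≤ 1 := by
  rw [taperMeasure, withDensity_apply _ MeasurableSet.univ, Measure.restrict_univ]
  calc ∫⁻ s in Ioc (0 : ℝ) 1, ENNReal.ofReal (1 - s)
      ≤ ∫⁻ _ in Ioc (0 : ℝ) 1, 1 := by
        refine setLIntegral_mono measurable_const fun s hs => ?_
        rw [← ENNReal.ofReal_one]
        exact ENNReal.ofReal_le_ofReal (by linarith [hs.1])
    _ = 1 := by simp

instance : IsFiniteMeasure taperMeasure :=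
  ⟨taperMeasure_univ_le.trans_lt ENNReal.one_lt_top⟩

theorem ae_taperMeasure : ∀ᵐ s ∂taperMeasure, s ∈ Icc (0 : ℝ) 1 :=
  (withDensity_absolutelyContinuous _ _).ae_le
    ((ae_restrict_mem measurableSet_Ioc).mono fun _ hs => Ioc_subset_Icc_self hs)

theorem integral_taperMeasure (F : ℝ → ℝ) :
    ∫ s, F s ∂taperMeasure = ∫ s in (0 : ℝ)..1, (1 - s) * F s := by
  rw [taperMeasure, integral_withDensity_eq_integral_toReal_smul (by fun_prop) (by simp),
    intervalIntegral.integral_of_le zero_le_one]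
  refine setIntegral_congr_fun measurableSet_Ioc fun s hs => ?_
  simp only [smul_eq_mul]
  rw [ENNReal.toReal_ofReal (by linarith [hs.2])]

/-- `∫₀¹ (1 - s) ψ(x - s e) ds`. -/
noncomputable def taper (e : Plane) (ψ : Plane → ℝ) (x : Plane) : ℝ :=
  ∫ s, ψ (x - s • e) ∂taperMeasure

/-- The average is a convolution of `ψ` with the image of the weight on the segment `[0,1] e`, so it
inherits the smoothness of `ψ`. -/
theorem contDiff_taper {e : Plane} {ψ : Plane → ℝ} (h : ContDiff ℝ ∞ ψ)
    (hs : HasCompactSupport ψ) : ContDiff ℝ ∞ (taper e ψ) := by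
  have key : taper e ψ = convolution (fun _ : Plane => (1 : ℝ)) ψ (ContinuousLinearMap.lsmul ℝ ℝ)
      (taperMeasure.map fun s => s • e) := by
    funext x
    rw [convolution_def, integral_map (by fun_prop)]
    · simp [taper]
    · have := h.continuous
      exact Continuous.aestronglyMeasurable (by simp; fun_prop)
  rw [key]
  exact hs.contDiff_convolution_right _ (locallyIntegrable_const 1) h

theorem fderiv_taper {e : Plane} {ψ : Plane → ℝ} (h : ContDiff ℝ ∞ ψ)
    (hs : HasCompactSupport ψ) (x v : Plane) :
    fderiv ℝ (taper e ψ) x v = taper e (fun y => fderiv ℝ ψ y v) x := by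
  have hc : Continuous (fderiv ℝ ψ) := h.continuous_fderiv (by simp)
  obtain ⟨C, hC⟩ := hc.bounded_above_of_compact_support (hs.fderiv (𝕜 := ℝ))
  obtain ⟨D, hD⟩ := h.continuous.bounded_above_of_compact_support hs
  have hψ := h.continuous
  have hd : HasFDerivAt (taper e ψ) (∫ s, fderiv ℝ ψ (x - s • e) ∂taperMeasure) x := by
    refine hasFDerivAt_integral_of_dominated_of_fderiv_le (bound := fun _ => C)
      (F := fun y s => ψ (y - s • e)) (F' := fun y s => fderiv ℝ ψ (y - s • e))
      univ_mem
      (Eventually.of_forall fun y => Continuous.aestronglyMeasurable (by fun_prop))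
      (.of_bound (C := D) (Continuous.aestronglyMeasurable (by fun_prop)) (ae_of_all _ fun s => hD _))
      (Continuous.aestronglyMeasurable (by fun_prop)) (ae_of_all _ fun s y _ => hC _)
      (integrable_const C) (ae_of_all _ fun s y _ => ?_)
    exact ((h.differentiable (by simp)) (y - s • e)).hasFDerivAt.comp y
      ((hasFDerivAt_id y).sub_const (s • e))
  rw [hd.fderiv, ContinuousLinearMap.integral_apply]
  · rfl
  · exact .of_bound (C := C) (Continuous.aestronglyMeasurable (by fun_prop))
      (ae_of_all _ fun s => hC _)

theorem abs_taper_le {e : Plane} {ψ : Plane → ℝ} {c : ℝ} (hc : ∀ x, |ψ x| ≤ c) (x : Plane) :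
    |taper e ψ x| ≤ c := by
  have h0 : 0 ≤ c := (abs_nonneg _).trans (hc 0)
  refine (norm_integral_le_of_norm_le_const (f := fun s : ℝ => ψ (x - s • e))
    (ae_of_all taperMeasure fun s => hc (x - s • e))).trans ?_
  refine mul_le_of_le_one_right h0 ?_
  exact ENNReal.toReal_le_of_le_ofReal zero_le_one (by simpa using taperMeasure_univ_le)

theorem tsupport_taper_subset {e : Plane} {ψ : Plane → ℝ} (hs : HasCompactSupport ψ) :
    HasCompactSupport (taper e ψ) ∧
      tsupport (taper e ψ) ⊆ (fun p : Plane × ℝ => p.1 + p.2 • e) '' (tsupport ψ ×ˢ Icc 0 1) := by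
  have hK : IsCompact ((fun p : Plane × ℝ => p.1 + p.2 • e) '' (tsupport ψ ×ˢ Icc 0 1)) :=
    (hs.isCompact.prod isCompact_Icc).image (by fun_prop)
  have hsub : Function.support (taper e ψ) ⊆
      (fun p : Plane × ℝ => p.1 + p.2 • e) '' (tsupport ψ ×ˢ Icc 0 1) := by
    intro x hx
    by_contra hn
    refine hx (integral_eq_zero_of_ae (ae_taperMeasure.mono fun s hs => ?_))
    by_contra h0
    exact hn ⟨(x - s • e, s), ⟨subset_tsupport _ h0, hs⟩, by simp⟩
  exact ⟨HasCompactSupport.of_support_subset_isCompact hK hsub,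
    closure_minimal hsub hK.isClosed⟩

/-- Taylor's formula with integral remainder along the segment from `x` to `x - e`. -/
theorem taper_fderiv_fderiv {e : Plane} {η : Plane → ℝ} (h : ContDiff ℝ ∞ η) (x : Plane) :
    taper e (fun y => fderiv ℝ (fun z => fderiv ℝ η z e) y e) x =
      η (x - e) + fderiv ℝ η x e - η x := by
  set η₁ : Plane → ℝ := fun z => fderiv ℝ η z e with hη₁
  have h1 : ContDiff ℝ ∞ η₁ := (h.fderiv_right (m := ∞) (by simp)).clm_apply contDiff_const
  have hline : ∀ s : ℝ, HasDerivAt (fun s : ℝ => x - s • e) (-e) s := fun s => by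
    simpa using ((hasDerivAt_id s).smul_const e).const_sub x
  have hcomp : ∀ {f : Plane → ℝ}, ContDiff ℝ ∞ f → ∀ s : ℝ,
      HasDerivAt (fun s : ℝ => f (x - s • e)) (-fderiv ℝ f (x - s • e) e) s := fun hf s => by
    simpa [Function.comp_def] using
      ((hf.differentiable (by simp)) (x - s • e)).hasFDerivAt.comp_hasDerivAt s (hline s)
  -- This antiderivative comes from integrating `(1 - s) ∂ₑ∂ₑη(x - s e)` by parts once.
  have hF : ∀ s : ℝ, HasDerivAt (fun s : ℝ => η (x - s • e) - (1 - s) * η₁ (x - s • e))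
      ((1 - s) * fderiv ℝ η₁ (x - s • e) e) s := fun s => by
    have h2 := (hcomp h s).sub ((((hasDerivAt_id s).const_sub 1)).mul (hcomp h1 s))
    refine h2.congr_deriv ?_
    simp only [id, hη₁]
    ring
  have hc : Continuous (fderiv ℝ η₁) := h1.continuous_fderiv (by simp)
  rw [taper, integral_taperMeasure, intervalIntegral.integral_eq_sub_of_hasDerivAt (fun s _ => hF s)
    (Continuous.intervalIntegrable (by fun_prop) _ _)]
  simp [hη₁]
  ring

/-- A test function `η` on `A` whose translates along `e` stay in `Ω` has derivative
`∂ₑη = ∂ₑ∂ₑζ + (η - η(· - e))` for a test function `ζ` on `Ω` with the same bound. -/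
theorem exists_second_primitive {Ω A : Set Plane} {e : Plane}
    (hA : ∀ y ∈ A, ∀ s ∈ Icc (0 : ℝ) 1, y + s • e ∈ Ω) {η : Plane → ℝ} (hη : IsTestFunction A η)
    {c : ℝ} (hc : ∀ x, |η x| ≤ c) :
    ∃ ζ, IsTestFunction Ω ζ ∧ (∀ x, |ζ x| ≤ c) ∧
      ∀ x, fderiv ℝ (fun y => fderiv ℝ ζ y e) x e = η (x - e) + fderiv ℝ η x e - η x := by
  obtain ⟨h, hs, hsub⟩ := hη
  refine ⟨taper e η, ⟨contDiff_taper h hs, (tsupport_taper_subset hs).1,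
    (tsupport_taper_subset hs).2.trans ?_⟩, abs_taper_le hc, fun x => ?_⟩
  · rintro _ ⟨p, hp, rfl⟩
    exact hA _ (hsub hp.1) _ hp.2
  · have h1 : ContDiff ℝ ∞ (fun z => fderiv ℝ η z e) :=
      (h.fderiv_right (m := ∞) (by simp)).clm_apply contDiff_const
    rw [← taper_fderiv_fderiv h x, ← fderiv_taper h1 (hs.fderiv_apply (𝕜 := ℝ) e)]
    congr 2
    funext y
    exact fderiv_taper h hs y e

/-! ### Density of test functions and duality -/

theorem IsTestFunction.mono {A Ω : Set Plane} {ψ : Plane → ℝ} (h : IsTestFunction A ψ)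
    (hA : A ⊆ Ω) : IsTestFunction Ω ψ := ⟨h.1, h.2.1, h.2.2.trans hA⟩

theorem IsTestFunction.eq_zero {A : Set Plane} {ψ : Plane → ℝ} (h : IsTestFunction A ψ)
    {x : Plane} (hx : x ∉ A) : ψ x = 0 :=
  image_eq_zero_of_notMem_tsupport fun h' => hx (h.2.2 h')

theorem IsTestFunction.exists_bound {A : Set Plane} {ψ : Plane → ℝ} (h : IsTestFunction A ψ) :
    ∃ C, ∀ x, ‖ψ x‖ ≤ C := h.1.continuous.bounded_above_of_compact_support h.2.1

/-- Uniform approximation of a compactly supported continuous function on an open set by test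
functions, with control of the support. -/
theorem exists_isTestFunction_abs_sub_lt {A : Set Plane} (hA : IsOpen A) {f : A → ℝ}
    (hf : Continuous f) (hs : HasCompactSupport f) {ε : ℝ} (hε : 0 < ε) :
    ∃ η, IsTestFunction A η ∧ (∀ x : A, |η x - f x| < ε) ∧
      ∀ x : A, x ∉ tsupport f → η x = 0 := by
  have hc := HasCompactSupport.continuous_extend_zero hA hf hs
  obtain ⟨η, h1, h2, h3⟩ := hc.exists_contDiff_approx ⊤ (ε := fun _ => ε) (by fun_prop)
    (fun _ => hε)
  have hext : ∀ x : A, Function.extend Subtype.val f 0 x = f x := fun x =>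
    Subtype.val_injective.extend_apply f 0 x
  have hes : HasCompactSupport (Function.extend Subtype.val f (0 : Plane → ℝ)) :=
    hs.extend_zero continuous_subtype_val
  refine ⟨η, ⟨h1, hes.mono h3, ?_⟩, fun x => ?_, fun x hx => ?_⟩
  · exact (closure_mono h3).trans ((hs.tsupport_extend_zero_subset continuous_subtype_val).trans
      (Subtype.coe_image_subset _ _))
  · rw [← hext x]
    exact h2 x
  · by_contra hn
    exact hx (subset_tsupport _ (by simpa [hext] using h3 hn))

/-- Approximation takes place first in `L¹` by continuous functions with compact support in the
subspace `A`, then uniformly by smooth functions vanishing off the same support. As that support has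
finite measure, the uniform error is also an `L¹` error. -/
theorem exists_isTestFunction_integral_abs_sub_le {A : Set Plane} (hA : IsOpen A) {g : Plane → ℝ}
    (hg : Integrable g (volume.restrict A)) {ε : ℝ} (hε : 0 < ε) :
    ∃ f, IsTestFunction A f ∧ ∫ x in A, |g x - f x| ≤ ε := by
  have := hA.locallyCompactSpace
  have hemb := MeasurableEmbedding.subtype_coe hA.measurableSet
  set ν : Measure A := volume.comap (Subtype.val : A → Plane) with hν
  have hg' : Integrable (fun x : A => g x) ν := by
    rw [← map_comap_subtype_coe hA.measurableSet] at hg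
    exact hemb.integrable_map_iff.1 hg
  have : IsFiniteMeasureOnCompacts ν :=
    IsFiniteMeasureOnCompacts.comap' _ continuous_subtype_val hemb
  obtain ⟨f, hf1, hf2, hf3, hf4⟩ := hg'.exists_hasCompactSupport_integral_sub_le (half_pos hε)
  set m : ℝ := ν.real (tsupport f)
  have hm : 0 ≤ m := measureReal_nonneg
  -- The `+ 1` covers a support of measure zero.
  set δ : ℝ := ε / 2 / (m + 1)
  have hδ : 0 < δ := by positivity
  have hδm : δ * m ≤ ε / 2 := by
    rw [div_mul_eq_mul_div, div_le_iff₀ (by positivity)]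
    nlinarith
  obtain ⟨η, h1, h2, h3⟩ := exists_isTestFunction_abs_sub_lt hA hf3 hf1 hδ
  refine ⟨η, h1, ?_⟩
  have hi : Integrable ((tsupport f).indicator fun _ => δ) ν :=
    IntegrableOn.integrable_indicator (integrableOn_const hf1.measure_lt_top.ne)
      (isClosed_tsupport f).measurableSet
  have hpt : ∀ x : A, |g x - η x| ≤ ‖g x - f x‖ + (tsupport f).indicator (fun _ => δ) x := by
    intro x
    have h4 : |η x - f x| ≤ (tsupport f).indicator (fun _ => δ) x := by
      by_cases hx : x ∈ tsupport f
      · rw [indicator_of_mem hx]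
        exact (h2 x).le
      · simp [indicator_of_notMem hx, image_eq_zero_of_notMem_tsupport hx, h3 x hx]
    have := abs_sub_le (g x) (f x) (η x)
    rw [abs_sub_comm (f x)] at this
    exact this.trans (add_le_add le_rfl h4)
  rw [← integral_subtype_comap hA.measurableSet (fun x => |g x - η x|)]
  calc ∫ x : A, |g x - η x| ∂ν
      ≤ ∫ x : A, (‖g x - f x‖ + (tsupport f).indicator (fun _ => δ) x) ∂ν :=
        integral_mono_of_nonneg (ae_of_all _ fun _ => abs_nonneg _)
          ((hg'.sub hf4).norm.add hi) (ae_of_all _ hpt)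
    _ = (∫ x : A, ‖g x - f x‖ ∂ν) + ∫ x : A, (tsupport f).indicator (fun _ => δ) x ∂ν :=
        integral_add (hg'.sub hf4).norm hi
    _ ≤ ε / 2 + ε / 2 := by
        refine add_le_add hf2 ?_
        rw [integral_indicator (isClosed_tsupport f).measurableSet, setIntegral_const, smul_eq_mul,
          mul_comm]
        exact hδm
    _ = ε := add_halves ε

/-- The `L¹` norm on an open set is determined by testing against `C_c^∞`. -/
theorem integral_abs_le_of_forall_isTestFunction {A : Set Plane} (hA : IsOpen A) {g : Plane → ℝ}
    (hg : Integrable g (volume.restrict A)) {K : ℝ}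
    (h : ∀ η, IsTestFunction A η → (∀ x, |η x| ≤ 1) → |∫ x in A, g x * η x| ≤ K) :
    ∫ x in A, |g x| ≤ K := by
  refine le_of_forall_pos_le_add fun ε hε => ?_
  -- The error `|g - f|` enters twice and the smoothing error `δ m` once, hence thirds.
  obtain ⟨f, hf, hfg⟩ := exists_isTestFunction_integral_abs_sub_le hA hg (ε := ε / 3) (by positivity)
  set m : ℝ := volume.real (tsupport f)
  have hm : 0 ≤ m := measureReal_nonneg
  obtain ⟨δ, hδ, hδm⟩ : ∃ δ : ℝ, 0 < δ ∧ δ * m ≤ ε / 3 :=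
    ⟨ε / 3 / (m + 1), by positivity, by
      rw [div_mul_eq_mul_div, div_le_iff₀ (by positivity)]; nlinarith⟩
  -- A smooth substitute for `|f|`: the quotient `f / r` is a smooth sign of `f`, bounded by `1` and
  -- supported where `f` is.
  set r : Plane → ℝ := fun x => √(f x ^ 2 + δ ^ 2)
  have hr : ∀ x, 0 < r x := fun x => Real.sqrt_pos.2 (by positivity)
  have hrf : ∀ x, |f x| ≤ r x := fun x => Real.abs_le_sqrt (by nlinarith)
  have hrd : ∀ x, r x ≤ |f x| + δ := fun x => by
    refine Real.sqrt_le_iff.2 ⟨by positivity, ?_⟩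
    nlinarith [sq_abs (f x), abs_nonneg (f x)]
  set η : Plane → ℝ := fun x => f x / r x
  have hη1 : ∀ x, |η x| ≤ 1 := fun x => by
    rw [abs_div, abs_of_pos (hr x)]
    exact div_le_one_of_le₀ (hrf x) (hr x).le
  have hη : IsTestFunction A η := by
    have hsupp : Function.support η ⊆ Function.support f := fun x hx hx' => hx (by simp [η, hx'])
    refine ⟨hf.1.div (ContDiff.sqrt (by have := hf.1; fun_prop) fun x => by positivity)
      fun x => (hr x).ne', hf.2.1.mono hsupp, (closure_mono hsupp).trans hf.2.2⟩
  have hηm := hη.1.continuous.aestronglyMeasurable (μ := volume.restrict A)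
  have hfi : Integrable f (volume.restrict A) :=
    (hf.1.continuous.integrable_of_hasCompactSupport hf.2.1).restrict
  have hgη : Integrable (fun x => g x * η x) (volume.restrict A) :=
    hg.mul_bdd hηm (ae_of_all _ hη1)
  have hi : Integrable ((tsupport f).indicator fun _ => δ) (volume.restrict A) := by
    refine IntegrableOn.integrable_indicator ?_ (isClosed_tsupport f).measurableSet
    exact integrableOn_const (((Measure.restrict_apply_le _ _).trans_lt
      hf.2.1.measure_lt_top).ne)
  have hd : Integrable (fun x => 2 * |g x - f x|) (volume.restrict A) :=
    (hg.sub hfi).abs.const_mul 2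
  have hpt : ∀ x, |g x| ≤ g x * η x + (tsupport f).indicator (fun _ => δ) x + 2 * |g x - f x| := by
    intro x
    have h1 : |f x| ≤ f x * η x + (tsupport f).indicator (fun _ => δ) x := by
      by_cases hx : x ∈ tsupport f
      · rw [indicator_of_mem hx, ← sub_le_iff_le_add]
        simp only [η]
        rw [← mul_div_assoc, le_div_iff₀ (hr x)]
        -- The claim is `(|f| - δ) r ≤ f²`. The left side is nonpositive if `|f| ≤ δ`; otherwise `r
        -- ≤ |f| + δ` gives a difference of squares.
        rcases le_total (|f x|) δ with h | h
        · nlinarith [hr x, sq_abs (f x), mul_self_nonneg (f x)]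
        · nlinarith [hrd x, sq_abs (f x)]
      · simp [indicator_of_notMem hx, image_eq_zero_of_notMem_tsupport hx]
    have h2 : |g x| ≤ |f x| + |g x - f x| := by
      have := abs_add_le (f x) (g x - f x); simpa using this
    have h3 : f x * η x ≤ g x * η x + |g x - f x| := by
      have : (f x - g x) * η x ≤ |g x - f x| := by
        refine (le_abs_self _).trans ?_
        rw [abs_mul, abs_sub_comm]
        exact mul_le_of_le_one_right (abs_nonneg _) (hη1 x)
      linarith
    linarith
  calc ∫ x in A, |g x|
      ≤ ∫ x in A, (g x * η x + (tsupport f).indicator (fun _ => δ) x + 2 * |g x - f x|) :=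
        integral_mono hg.abs ((hgη.add hi).add hd) hpt
    _ = (∫ x in A, g x * η x) + (∫ x in A, (tsupport f).indicator (fun _ => δ) x) +
          2 * ∫ x in A, |g x - f x| := by
        rw [integral_add (f := fun x => g x * η x + (tsupport f).indicator (fun _ => δ) x)
          (hgη.add hi) hd, integral_add hgη hi, integral_const_mul]
    _ ≤ K + ε / 3 + 2 * (ε / 3) := by
        refine add_le_add (add_le_add ((le_abs_self _).trans (h η hη hη1)) ?_) (by linarith)
        rw [setIntegral_indicator (isClosed_tsupport f).measurableSet, setIntegral_const,
          smul_eq_mul]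
        refine le_trans ?_ hδm
        rw [mul_comm]
        gcongr
        exact measureReal_mono inter_subset_right hf.2.1.measure_lt_top.ne
    _ = K + ε := by ring

/-! ### Bounds by the total variation of the second derivative -/

theorem IsTestFunction.pderiv {Ω : Set Plane} {ψ : Plane → ℝ} (h : IsTestFunction Ω ψ) (i : Fin 2) :
    IsTestFunction Ω (pderiv i ψ) :=
  ⟨pderiv_contDiff h.1 i, pderiv_hasCompactSupport h.2.1 i,
    (tsupport_fderiv_apply_subset ℝ _).trans h.2.2⟩

theorem IsTestFunction.integrable_mul {Ω : Set Plane} {ψ : Plane → ℝ} (h : IsTestFunction Ω ψ)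
    {f : Plane → ℝ} {μ : Measure Plane} (hf : Integrable f μ) :
    Integrable (fun x => f x * ψ x) μ := by
  obtain ⟨C, hC⟩ := h.exists_bound
  exact hf.mul_bdd h.1.continuous.aestronglyMeasurable (ae_of_all _ hC)

theorem pderiv_const_mul {ψ : Plane → ℝ} (h : ContDiff ℝ ∞ ψ) (c : ℝ) (i : Fin 2) :
    pderiv i (fun x => c * ψ x) = fun x => c * pderiv i ψ x := by
  funext x
  simp only [pderiv]
  rw [fderiv_const_mul ((h.differentiable (by simp)) x)]
  simp

theorem fderiv_apply_eq_sum_pderiv (ψ : Plane → ℝ) (x e : Plane) :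
    fderiv ℝ ψ x e = ∑ i, e i * pderiv i ψ x := by
  have he : e = ∑ i, e i • EuclideanSpace.single i (1 : ℝ) := by
    ext j
    fin_cases j <;> simp
  conv_lhs => rw [he]
  simp [pderiv]

theorem pderiv_comm {ψ : Plane → ℝ} (h : ContDiff ℝ ∞ ψ) (i j : Fin 2) (x : Plane) :
    pderiv i (pderiv j ψ) x = pderiv j (pderiv i ψ) x := by
  have hd : Differentiable ℝ (fderiv ℝ ψ) :=
    (h.fderiv_right (m := ∞) (by simp)).differentiable (by simp)
  have key : ∀ i j : Fin 2, pderiv i (pderiv j ψ) x =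
      fderiv ℝ (fderiv ℝ ψ) x (EuclideanSpace.single i 1) (EuclideanSpace.single j 1) := by
    intro i j
    have := (hd x).hasFDerivAt.clm_apply (hasFDerivAt_const (EuclideanSpace.single j (1 : ℝ)) x)
    change fderiv ℝ (fun y => fderiv ℝ ψ y (EuclideanSpace.single j 1)) x _ = _
    rw [this.fderiv]
    simp
  rw [key, key]
  exact (h.contDiffAt.isSymmSndFDerivAt
    (by simpa using WithTop.coe_le_coe.2 (le_top : (2 : ℕ∞) ≤ ⊤))) _ _

theorem integral_divDiv_le {Ω : Set Plane} {u : L1 Ω ℝ} (hu : hessVariation Ω u ≠ ⊤)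
    {φ : Plane → Matrix (Fin 2) (Fin 2) ℝ} (hφ : IsAdmissible Ω φ) :
    ∫ x in Ω, u x * divDiv φ x ≤ (hessVariation Ω u).toReal := by
  refine (le_max_left _ 0).trans ?_
  rw [← ENNReal.toReal_ofReal']
  exact ENNReal.toReal_mono hu (le_iSup₂ (f := fun φ (_ : IsAdmissible Ω φ) =>
    ENNReal.ofReal (∫ x in Ω, u x * divDiv φ x)) φ hφ)

/-- Testing `D²u` against `ζ S` for a constant symmetric matrix `S`. -/
theorem abs_integral_mul_sum_pderiv_le {Ω : Set Plane} {u : L1 Ω ℝ} (hu : hessVariation Ω u ≠ ⊤)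
    {ζ : Plane → ℝ} (hζ : IsTestFunction Ω ζ) {c N : ℝ} (hc : 0 < c) (hN : 0 < N)
    (hζc : ∀ x ∈ Ω, |ζ x| ≤ c) {S : Matrix (Fin 2) (Fin 2) ℝ} (hS : S.IsSymm)
    (hSN : ∑ i, ∑ j, S i j ^ 2 ≤ N ^ 2) :
    |∫ x in Ω, u x * ∑ i, ∑ j, S i j * pderiv i (pderiv j ζ) x| ≤
      c * N * (hessVariation Ω u).toReal := by
  have key : ∀ t : ℝ, t ^ 2 = 1 →
      t * ∫ x in Ω, u x * ∑ i, ∑ j, S i j * pderiv i (pderiv j ζ) x ≤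
        c * N * (hessVariation Ω u).toReal := by
    intro t ht
    -- The sign `t = ±1` yields both halves of the absolute value; dividing by `c N` brings the
    -- Frobenius norm of `ζ S` below `1`.
    have hadm : IsAdmissible Ω fun x => fun i j => (t * (c * N)⁻¹ * S i j) * ζ x := by
      refine ⟨fun i j => ⟨contDiff_const.mul hζ.1, hζ.2.1.mul_left,
        (closure_mono (Function.support_mul_subset_right _ _)).trans hζ.2.2⟩, fun x => ?_,
        fun x hx => ?_⟩
      · ext i j
        change (t * (c * N)⁻¹ * S j i) * ζ x = (t * (c * N)⁻¹ * S i j) * ζ x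
        rw [hS.apply]
      · rw [Real.sqrt_le_one]
        have h1 : ∑ i, ∑ j, ((t * (c * N)⁻¹ * S i j) * ζ x) ^ 2 =
            (∑ i, ∑ j, S i j ^ 2) * ζ x ^ 2 / (c * N) ^ 2 := by
          simp only [Finset.sum_mul, Finset.sum_div]
          refine Finset.sum_congr rfl fun i _ => Finset.sum_congr rfl fun j _ => ?_
          simp only [mul_pow, ht, inv_pow]
          field_simp
        rw [h1]
        refine div_le_one_of_le₀ ?_ (by positivity)
        have h2 : ζ x ^ 2 ≤ c ^ 2 := sq_le_sq' (abs_le.1 (hζc x hx)).1 (abs_le.1 (hζc x hx)).2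
        rw [mul_pow, mul_comm]
        exact mul_le_mul h2 hSN (by positivity) (by positivity)
    have h := integral_divDiv_le hu hadm
    have hdd : ∀ x, divDiv (fun x => fun i j => (t * (c * N)⁻¹ * S i j) * ζ x) x =
        t * (c * N)⁻¹ * ∑ i, ∑ j, S i j * pderiv i (pderiv j ζ) x := by
      intro x
      simp only [divDiv, Finset.mul_sum]
      refine Finset.sum_congr rfl fun i _ => Finset.sum_congr rfl fun j _ => ?_
      rw [pderiv_const_mul hζ.1, pderiv_const_mul (pderiv_contDiff hζ.1 j)]
      ring
    simp only [hdd] at h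
    have h3 : ∫ x in Ω, u x * (t * (c * N)⁻¹ * ∑ i, ∑ j, S i j * pderiv i (pderiv j ζ) x) =
        (c * N)⁻¹ * (t * ∫ x in Ω, u x * ∑ i, ∑ j, S i j * pderiv i (pderiv j ζ) x) := by
      rw [← integral_const_mul, ← integral_const_mul]
      congr 1
      funext x
      ring
    rwa [h3, inv_mul_le_iff₀ (by positivity)] at h
  exact abs_le'.2 ⟨by simpa using key 1 (by norm_num), by simpa using key (-1) (by norm_num)⟩

/-- The operator `∂ₑ∂ₑ` is the contraction of `D²` with the symmetric matrix `e ⊗ e`, whose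
Frobenius norm is `‖e‖²`. A separate `N > 0` allows `e = 0`. -/
theorem abs_integral_mul_fderiv_fderiv_le {Ω : Set Plane} {u : L1 Ω ℝ}
    (hu : hessVariation Ω u ≠ ⊤) {ζ : Plane → ℝ} (hζ : IsTestFunction Ω ζ) (hζ1 : ∀ x, |ζ x| ≤ 1)
    {e : Plane} {N : ℝ} (hN : 0 < N) (he : ‖e‖ ^ 2 ≤ N) :
    |∫ x in Ω, u x * fderiv ℝ (fun y => fderiv ℝ ζ y e) x e| ≤ N * (hessVariation Ω u).toReal := by
  have h1 : ∀ x, fderiv ℝ (fun y => fderiv ℝ ζ y e) x e =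
      ∑ i, ∑ j, (Matrix.of fun i j => e i * e j) i j * pderiv i (pderiv j ζ) x := by
    intro x
    rw [fderiv_apply_eq_sum_pderiv]
    refine Finset.sum_congr rfl fun i _ => ?_
    have h2 : (fun y => fderiv ℝ ζ y e) = fun y => ∑ j, e j * pderiv j ζ y :=
      funext fun y => fderiv_apply_eq_sum_pderiv ζ y e
    have h3 : pderiv i (fun y => ∑ j, e j * pderiv j ζ y) x =
        ∑ j, e j * pderiv i (pderiv j ζ) x := by
      have hd : ∀ j, DifferentiableAt ℝ (fun y => e j * pderiv j ζ y) x := fun j =>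
        ((contDiff_const.mul (pderiv_contDiff hζ.1 j)).differentiable (by simp)) x
      conv_lhs => rw [pderiv, fderiv_fun_sum fun j _ => hd j, sum_apply]
      exact Finset.sum_congr rfl fun j _ =>
        congrFun (pderiv_const_mul (pderiv_contDiff hζ.1 j) (e j) i) x
    rw [h2, h3, Finset.mul_sum]
    exact Finset.sum_congr rfl fun j _ => by simp [mul_assoc]
  simp only [h1]
  have := abs_integral_mul_sum_pderiv_le hu hζ one_pos hN (fun x _ => hζ1 x)
    (S := Matrix.of fun i j => e i * e j) (by ext i j; simp [mul_comm]) ?_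
  · simpa using this
  · have h4 : ∑ i, ∑ j, (Matrix.of fun i j => e i * e j) i j ^ 2 = (‖e‖ ^ 2) ^ 2 := by
      rw [EuclideanSpace.real_norm_sq_eq]
      simp [Fin.sum_univ_two]
      ring
    rw [h4]
    gcongr

/-- A component of `D²u` is bounded by the total variation in the dual of `C_c^∞`. -/
theorem abs_integral_mul_pderiv_pderiv_le {Ω : Set Plane} {u : L1 Ω ℝ}
    (hu : hessVariation Ω u ≠ ⊤) {ζ : Plane → ℝ} (hζ : IsTestFunction Ω ζ) {c : ℝ} (hc : 0 < c)
    (hζc : ∀ x ∈ Ω, |ζ x| ≤ c) (i j : Fin 2) :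
    |∫ x in Ω, u x * pderiv i (pderiv j ζ) x| ≤ c * (hessVariation Ω u).toReal := by
  -- Admissible fields are symmetric, so the matrix unit is symmetrised; by symmetry of second
  -- derivatives this does not change the integrand.
  have key := abs_integral_mul_sum_pderiv_le hu hζ hc one_pos hζc
    (S := Matrix.of fun k l => ((if k = i ∧ l = j then 1 else 0) +
      if k = j ∧ l = i then 1 else 0) / 2)
    (by ext k l; simp only [Matrix.transpose_apply, Matrix.of_apply]; rw [add_comm]; simp [and_comm])
    (by
      simp only [Fin.sum_univ_two, Matrix.of_apply]
      fin_cases i <;> fin_cases j <;> norm_num)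
  have h : ∀ x, ∑ k, ∑ l, (Matrix.of fun k l => (((if k = i ∧ l = j then 1 else 0) +
      if k = j ∧ l = i then 1 else 0) / 2 : ℝ)) k l * pderiv k (pderiv l ζ) x =
      pderiv i (pderiv j ζ) x := by
    intro x
    have h1 := pderiv_comm hζ.1 0 1 x
    fin_cases i <;> fin_cases j <;> simp [Fin.sum_univ_two, h1] <;> ring
  simp only [h] at key
  simpa using key

/-- Interpolation: where the translates `A + [0,1] e` stay in `Ω`, the derivative along `e` is
controlled by the second derivatives and the `L¹` norm. -/
theorem integral_abs_inner_grad_sub_le {Ω A : Set Plane} (hA : IsOpen A) (hAΩ : A ⊆ Ω)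
    {e : Plane} (hAe : ∀ y ∈ A, ∀ s ∈ Icc (0 : ℝ) 1, y + s • e ∈ Ω) {N : ℝ} (hN : 0 < N)
    (he : ‖e‖ ^ 2 ≤ N) (u v : HB Ω) :
    ∫ x in A, |∑ i, (u.grad x i - v.grad x i) * e i| ≤
      N * ((hessVariation Ω u.toL1).toReal + (hessVariation Ω v.toL1).toReal) +
        2 * ‖u.toL1 - v.toL1‖ := by
  have hgi : ∀ (w : HB Ω) i, Integrable (fun x => w.grad x i) (volume.restrict Ω) := fun w i =>
    (EuclideanSpace.proj (𝕜 := ℝ) i).integrable_comp (L1.integrable_coeFn w.grad)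
  have hgΩ : Integrable (fun x => ∑ i, (u.grad x i - v.grad x i) * e i) (volume.restrict Ω) :=
    integrable_finsetSum _ fun i _ => ((hgi u i).sub (hgi v i)).mul_const _
  have hui := L1.integrable_coeFn u.toL1
  have hvi := L1.integrable_coeFn v.toL1
  refine integral_abs_le_of_forall_isTestFunction hA
    (hgΩ.mono_measure (Measure.restrict_mono hAΩ le_rfl)) fun η hη hη1 => ?_
  have hηΩ := hη.mono hAΩ
  obtain ⟨ζ, hζ, hζ1, hζe⟩ := exists_second_primitive hAe hη hη1
  have hηe : IsTestFunction Ω fun x => fderiv ℝ η x e :=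
    ⟨(hη.1.fderiv_right (m := ∞) (by simp)).clm_apply contDiff_const,
      hη.2.1.fderiv_apply (𝕜 := ℝ) e, (tsupport_fderiv_apply_subset ℝ _).trans hηΩ.2.2⟩
  have hζ' : IsTestFunction Ω fun x => fderiv ℝ ζ x e :=
    ⟨(hζ.1.fderiv_right (m := ∞) (by simp)).clm_apply contDiff_const,
      hζ.2.1.fderiv_apply (𝕜 := ℝ) e, (tsupport_fderiv_apply_subset ℝ _).trans hζ.2.2⟩
  have hζ'' : IsTestFunction Ω fun x => fderiv ℝ (fun y => fderiv ℝ ζ y e) x e :=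
    ⟨(hζ'.1.fderiv_right (m := ∞) (by simp)).clm_apply contDiff_const,
      hζ'.2.1.fderiv_apply (𝕜 := ℝ) e, (tsupport_fderiv_apply_subset ℝ _).trans hζ'.2.2⟩
  have hgrad : ∀ w : HB Ω, ∫ x in Ω, (∑ i, w.grad x i * e i) * η x =
      -∫ x in Ω, w.toL1 x * fderiv ℝ η x e := by
    intro w
    simp only [fderiv_apply_eq_sum_pderiv, Finset.sum_mul, Finset.mul_sum]
    rw [integral_finsetSum _ fun i _ => hηΩ.integrable_mul ((hgi w i).mul_const _),
      integral_finsetSum, ← Finset.sum_neg_distrib]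
    · refine Finset.sum_congr rfl fun i _ => ?_
      have h := w.hasWeakGradient_grad η hηΩ i
      have e1 : ∫ x in Ω, w.grad x i * e i * η x = e i * ∫ x in Ω, w.grad x i * η x := by
        rw [← integral_const_mul]; congr 1; funext x; ring
      have e2 : ∫ x in Ω, w.toL1 x * (e i * pderiv i η x) =
          e i * ∫ x in Ω, w.toL1 x * pderiv i η x := by
        rw [← integral_const_mul]; congr 1; funext x; ring
      rw [e1, e2, h]
      ring
    · intro i _
      have := ((hηΩ.pderiv i).integrable_mul (L1.integrable_coeFn w.toL1)).const_mul (e i)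
      exact this.congr (ae_of_all _ fun x => by ring)
  -- The derivative is moved onto `η` and `∂ₑη` is replaced by `∂ₑ∂ₑζ + (η - η(· - e))`. The first
  -- part is controlled by the variations, the second by the `L¹` norm.
  have hsplit : ∫ x in A, (∑ i, (u.grad x i - v.grad x i) * e i) * η x =
      -(∫ x in Ω, u.toL1 x * fderiv ℝ (fun y => fderiv ℝ ζ y e) x e) +
        (∫ x in Ω, v.toL1 x * fderiv ℝ (fun y => fderiv ℝ ζ y e) x e) +
        ∫ x in Ω, (u.toL1 x - v.toL1 x) * (η (x - e) - η x) := by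
    have hsum : ∀ w : HB Ω, Integrable (fun x => ∑ i, w.grad x i * e i) (volume.restrict Ω) :=
      fun w => integrable_finsetSum _ fun i _ => (hgi w i).mul_const _
    have e0 : ∫ x in A, (∑ i, (u.grad x i - v.grad x i) * e i) * η x =
        ∫ x in Ω, (∑ i, (u.grad x i - v.grad x i) * e i) * η x := by
      rw [setIntegral_eq_integral_of_forall_compl_eq_zero fun x hx => by simp [hη.eq_zero hx],
        setIntegral_eq_integral_of_forall_compl_eq_zero fun x hx => by simp [hηΩ.eq_zero hx]]
    have e1 : ∫ x in Ω, (∑ i, (u.grad x i - v.grad x i) * e i) * η x =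
        (∫ x in Ω, (∑ i, u.grad x i * e i) * η x) - ∫ x in Ω, (∑ i, v.grad x i * e i) * η x := by
      rw [← integral_sub (hηΩ.integrable_mul (hsum u)) (hηΩ.integrable_mul (hsum v))]
      congr 1
      funext x
      simp only [sub_mul, Finset.sum_sub_distrib]
    have e2 : ∫ x in Ω, (u.toL1 x - v.toL1 x) * (η (x - e) - η x) =
        ((∫ x in Ω, u.toL1 x * fderiv ℝ (fun y => fderiv ℝ ζ y e) x e) -
        (∫ x in Ω, v.toL1 x * fderiv ℝ (fun y => fderiv ℝ ζ y e) x e)) -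
        ((∫ x in Ω, u.toL1 x * fderiv ℝ η x e) - ∫ x in Ω, v.toL1 x * fderiv ℝ η x e) := by
      have i1 := hζ''.integrable_mul (hui.sub hvi)
      have i2 := hηe.integrable_mul (hui.sub hvi)
      rw [← integral_sub (hζ''.integrable_mul hui) (hζ''.integrable_mul hvi),
        ← integral_sub (hηe.integrable_mul hui) (hηe.integrable_mul hvi)]
      simp only [← sub_mul]
      refine Eq.trans ?_ (integral_sub i1 i2)
      congr 1
      funext x
      simp only [hζe]
      ring
    rw [e0, e1, e2, hgrad, hgrad]
    ring
  have hlast : |∫ x in Ω, (u.toL1 x - v.toL1 x) * (η (x - e) - η x)| ≤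
      2 * ‖u.toL1 - v.toL1‖ := by
    have hnorm : ‖u.toL1 - v.toL1‖ = ∫ x in Ω, ‖u.toL1 x - v.toL1 x‖ := by
      rw [L1.norm_eq_integral_norm]
      exact integral_congr_ae ((Lp.coeFn_sub u.toL1 v.toL1).mono fun x hx => congrArg norm hx)
    rw [hnorm, ← integral_const_mul, ← Real.norm_eq_abs]
    refine norm_integral_le_of_norm_le ((hui.sub hvi).norm.const_mul 2) (ae_of_all _ fun x => ?_)
    rw [norm_mul, mul_comm]
    gcongr
    have h1 := hη1 x
    have h2 := hη1 (x - e)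
    rw [Real.norm_eq_abs]
    rw [abs_le] at *
    constructor <;> linarith [h1.1, h1.2, h2.1, h2.2]
  rw [hsplit]
  have hu' := abs_integral_mul_fderiv_fderiv_le u.hessVariation_ne_top hζ hζ1 hN he
  have hv' := abs_integral_mul_fderiv_fderiv_le v.hessVariation_ne_top hζ hζ1 hN he
  refine (abs_add_three _ _ _).trans ?_
  rw [abs_neg]
  linarith

/-! ### The interior cone condition -/

/-- Near `x`, the points of `Ω` can be moved inside `Ω` along an open set of directions. -/
def HasInteriorCone (Ω : Set Plane) (x : Plane) : Prop :=
  ∃ U, IsOpen U ∧ x ∈ U ∧ ∃ (e₀ : Plane) (r τ : ℝ), 0 < r ∧ 0 < τ ∧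
    ∀ e ∈ Metric.ball e₀ r, ∀ y ∈ U ∩ Ω, ∀ t ∈ Icc (0 : ℝ) τ, y + t • e ∈ Ω

theorem hasInteriorCone_of_mem {Ω : Set Plane} (hΩ : IsOpen Ω) {x : Plane} (hx : x ∈ Ω) :
    HasInteriorCone Ω x := by
  obtain ⟨ρ, hρ, hsub⟩ := Metric.isOpen_iff.1 hΩ x hx
  refine ⟨Metric.ball x (ρ / 2), Metric.isOpen_ball, Metric.mem_ball_self (by positivity), 0,
    ρ / 2, 1, by positivity, one_pos, fun e he y hy t ht => hsub ?_⟩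
  have h1 := mem_ball_zero_iff.1 he
  have h2 := mem_ball_iff_norm.1 hy.1
  rw [mem_ball_iff_norm]
  calc ‖y + t • e - x‖ = ‖(y - x) + t • e‖ := by congr 1; abel
    _ ≤ ‖y - x‖ + ‖t • e‖ := norm_add_le _ _
    _ ≤ ‖y - x‖ + ‖e‖ := by
        gcongr
        rw [norm_smul, Real.norm_of_nonneg ht.1]
        exact mul_le_of_le_one_left (norm_nonneg _) ht.2
    _ < ρ := by linarith

/-- A chart that maps `Ω` to a set given by the positivity of some of the coordinates yields an
interior cone. -/
theorem hasInteriorCone_of_chart {Ω : Set Plane} {x : Plane}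
    {φ : OpenPartialHomeomorph Plane Plane} (hφ : IsC3Chart φ) (hx : x ∈ φ.source) {I : Set (Fin 2)}
    (hI : φ '' (φ.source ∩ Ω) = {y | y ∈ square ∧ ∀ i ∈ I, 0 < y i}) : HasInteriorCone Ω x := by
  obtain ⟨ht, hc, hc'⟩ := hφ
  set L := fderiv ℝ φ x
  have hcx : ContDiffAt ℝ 3 φ x := hc.contDiffAt (φ.open_source.mem_nhds hx)
  have hsx : HasStrictFDerivAt φ L x := hcx.hasStrictFDerivAt (by norm_num)
  have hcy : ContDiffAt ℝ 3 φ.symm (φ x) := hc'.contDiffAt (φ.open_target.mem_nhds (φ.map_source hx))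
  have hinv : L ∘L fderiv ℝ φ.symm (φ x) = ContinuousLinearMap.id ℝ Plane := by
    have h1 : HasFDerivAt (φ ∘ φ.symm) (L ∘L fderiv ℝ φ.symm (φ x)) (φ x) := by
      refine HasFDerivAt.comp (φ x) ?_ (hcy.differentiableAt (by norm_num)).hasFDerivAt
      rw [φ.left_inv hx]
      exact hsx.hasFDerivAt
    have h2 : HasFDerivAt (φ ∘ φ.symm) (ContinuousLinearMap.id ℝ Plane) (φ x) :=
      (hasFDerivAt_id _).congr_of_eventuallyEq
        (φ.eventually_right_inverse (φ.map_source hx))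
    exact h1.unique h2
  -- The direction `e₀` is the pullback of `(1,1)`, which points into both the half square and the
  -- quarter square. Nearby directions still raise each coordinate at a rate above `1/2`.
  obtain ⟨e₀, he₀⟩ : ∃ e₀, ∀ i, L e₀ i = 1 :=
    ⟨fderiv ℝ φ.symm (φ x) (WithLp.toLp 2 fun _ => 1), fun i => by
      have := congrArg (fun T : Plane →L[ℝ] Plane => T (WithLp.toLp 2 fun _ => 1) i) hinv
      simpa using this⟩
  obtain ⟨r, hr, hrL⟩ : ∃ r > 0, ∀ e ∈ Metric.ball e₀ r, ∀ i, 1 / 2 < L e i := by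
    have : ∀ᶠ e in 𝓝 e₀, ∀ i, 1 / 2 < L e i := by
      refine eventually_all.2 fun i => ?_
      have hcont : Continuous fun e => L e i := by fun_prop
      exact hcont.continuousAt.eventually (lt_mem_nhds (by
        beta_reduce
        rw [he₀]
        norm_num))
    exact Metric.eventually_nhds_iff_ball.1 this
  set R : ℝ := ‖e₀‖ + r
  have hR : 0 < R := by positivity
  have hcpos : 0 < 1 / (2 * R) := by positivity
  -- With `‖e‖ < R`, the linearisation error over a step `t e` is at most `t / 2`, which the
  -- increase of the linear part compensates.
  obtain ⟨s, hs, happ⟩ := hsx.approximates_deriv_on_nhds (c := (1 / (2 * R)).toNNReal)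
    (Or.inr (Real.toNNReal_pos.2 hcpos))
  obtain ⟨ρ, hρ, hsub⟩ := Metric.mem_nhds_iff.1 (inter_mem hs (φ.open_source.mem_nhds hx))
  -- Starting points within `ρ / 2` of `x` and steps of length at most `ρ / 2` keep the segment
  -- where the linearisation is valid.
  refine ⟨Metric.ball x (ρ / 2), Metric.isOpen_ball, Metric.mem_ball_self (by positivity), e₀, r,
    ρ / 2 / R, hr, by positivity, fun e he y hy t htt => ?_⟩
  have heR : ‖e‖ < R := by
    have := mem_ball_iff_norm.1 he
    calc ‖e‖ = ‖e₀ + (e - e₀)‖ := by simp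
      _ ≤ ‖e₀‖ + ‖e - e₀‖ := norm_add_le _ _
      _ < R := by simp only [R]; linarith
  have hte : ‖t • e‖ ≤ ρ / 2 := by
    rw [norm_smul, Real.norm_of_nonneg htt.1]
    calc t * ‖e‖ ≤ (ρ / 2 / R) * R := mul_le_mul htt.2 heR.le (norm_nonneg _) (by positivity)
      _ = ρ / 2 := by field_simp
  have hyx := mem_ball_iff_norm.1 hy.1
  have hy' : y ∈ s ∩ φ.source := hsub (Metric.ball_subset_ball (by linarith) hy.1)
  have hz' : y + t • e ∈ s ∩ φ.source := by
    refine hsub (mem_ball_iff_norm.2 ?_)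
    calc ‖y + t • e - x‖ = ‖(y - x) + t • e‖ := by congr 1; abel
      _ ≤ ‖y - x‖ + ‖t • e‖ := norm_add_le _ _
      _ < ρ := by linarith
  have hmono : ∀ i, φ y i ≤ φ (y + t • e) i := by
    intro i
    have h1 := happ _ hz'.1 _ hy'.1
    rw [add_sub_cancel_left, Real.coe_toNNReal _ hcpos.le] at h1
    have h2 := (PiLp.norm_apply_le (φ (y + t • e) - φ y - L (t • e)) i).trans h1
    rw [Real.norm_eq_abs] at h2
    have h3 := (abs_le.1 h2).1
    have h4 : 1 / (2 * R) * ‖t • e‖ ≤ t * (1 / 2) := by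
      rw [norm_smul, Real.norm_of_nonneg htt.1]
      calc 1 / (2 * R) * (t * ‖e‖) = t * (‖e‖ / R) * (1 / 2) := by field_simp
        _ ≤ t * 1 * (1 / 2) := by
            gcongr
            · exact htt.1
            · exact div_le_one_of_le₀ heR.le hR.le
        _ = t * (1 / 2) := by ring
    have h5 : t * (1 / 2) ≤ t * L e i := mul_le_mul_of_nonneg_left (hrL e he i).le htt.1
    simp only [PiLp.sub_apply, map_smul, PiLp.smul_apply, smul_eq_mul] at h3
    linarith
  have hφy : φ y ∈ {y | y ∈ square ∧ ∀ i ∈ I, 0 < y i} := by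
    rw [← hI]
    exact mem_image_of_mem _ ⟨hy'.2, hy.2⟩
  have hφz : φ (y + t • e) ∈ φ '' (φ.source ∩ Ω) := by
    rw [hI]
    refine ⟨?_, fun i hi => (hφy.2 i hi).trans_le (hmono i)⟩
    rw [← ht]
    exact φ.map_source hz'.2
  obtain ⟨z, hz, hzeq⟩ := hφz
  -- Injectivity of the chart brings membership in the image back to membership in `Ω`.
  rw [← φ.injOn hz.1 hz'.2 hzeq]
  exact hz.2

theorem IsPiecewiseC3Domain.hasInteriorCone {Ω : Set Plane} (hΩ : IsPiecewiseC3Domain Ω) {x : Plane}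
    (hx : x ∈ closure Ω) : HasInteriorCone Ω x := by
  by_cases hxΩ : x ∈ Ω
  · exact hasInteriorCone_of_mem hΩ.isOpen hxΩ
  have hfr : x ∈ frontier Ω := by
    rw [hΩ.isOpen.frontier_eq]
    exact ⟨hx, hxΩ⟩
  obtain ⟨S, -, hreg, e, he, -⟩ := hΩ.boundary
  by_cases hxS : x ∈ S
  · obtain ⟨h1, h2, -, h3⟩ := he x hxS
    exact hasInteriorCone_of_chart h1 h2 (I := univ) (h3.trans (by ext y; simp [Fin.forall_fin_two]))
  · obtain ⟨φ, h1, h2, -, h3⟩ := hreg x hfr hxS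
    exact hasInteriorCone_of_chart h1 h2 (I := {1}) (h3.trans (by ext y; simp))

/-! ### Convergence in the intermediate topology -/

section Convergence

variable {Ω : Set Plane} {u : HB Ω} {v : ℕ → HB Ω}

theorem tendsto_norm_sub_of_intermediateDist
    (hv : Tendsto (fun n => HB.intermediateDist u (v n)) atTop (𝓝 0)) :
    Tendsto (fun n => ‖u.toL1 - (v n).toL1‖) atTop (𝓝 0) :=
  squeeze_zero (fun _ => norm_nonneg _) (fun _ => le_add_of_nonneg_right (abs_nonneg _)) hv

theorem eventually_hessVariation_le_of_intermediateDist
    (hv : Tendsto (fun n => HB.intermediateDist u (v n)) atTop (𝓝 0)) :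
    ∀ᶠ n in atTop, (hessVariation Ω (v n).toL1).toReal ≤ (hessVariation Ω u.toL1).toReal + 1 := by
  filter_upwards [hv.eventually (gt_mem_nhds one_pos)] with n hn
  have h1 : |(hessVariation Ω u.toL1).toReal - (hessVariation Ω (v n).toL1).toReal| < 1 :=
    (le_add_of_nonneg_left (norm_nonneg _)).trans_lt hn
  linarith [(abs_lt.1 h1).1]

theorem tendsto_toL1_of_intermediateDist
    (hv : Tendsto (fun n => HB.intermediateDist u (v n)) atTop (𝓝 0)) :
    Tendsto (fun n => (v n).toL1) atTop (𝓝 u.toL1) := by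
  rw [tendsto_iff_norm_sub_tendsto_zero]
  simpa only [norm_sub_rev] using tendsto_norm_sub_of_intermediateDist hv

/-- The interpolation bound for `h e`, divided by `h`, is `h N C + 2‖u - v n‖₁ / h`: the step `h` is
fixed first, then `n` grows. -/
theorem tendsto_integral_abs_inner_grad_sub
    (hv : Tendsto (fun n => HB.intermediateDist u (v n)) atTop (𝓝 0)) {A : Set Plane}
    (hA : IsOpen A) (hAΩ : A ⊆ Ω) {e : Plane} {τ : ℝ} (hτ : 0 < τ)
    (hAe : ∀ y ∈ A, ∀ t ∈ Icc (0 : ℝ) τ, y + t • e ∈ Ω) :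
    Tendsto (fun n => ∫ x in A, |∑ i, (u.grad x i - (v n).grad x i) * e i|) atTop (𝓝 0) := by
  set N : ℝ := ‖e‖ ^ 2 + 1
  have hN : 0 < N := by positivity
  set C : ℝ := 2 * (hessVariation Ω u.toL1).toReal + 1
  have hC : 0 < C := by positivity
  have hbound : ∀ h ∈ Ioc 0 τ, ∀ᶠ n in atTop,
      ∫ x in A, |∑ i, (u.grad x i - (v n).grad x i) * e i| ≤
        h * (N * C) + 2 * ‖u.toL1 - (v n).toL1‖ / h := by
    intro h hh
    filter_upwards [eventually_hessVariation_le_of_intermediateDist hv] with n hn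
    have key := integral_abs_inner_grad_sub_le hA hAΩ (e := h • e) (fun y hy s hs => by
      rw [smul_smul]
      exact hAe y hy _ ⟨mul_nonneg hs.1 hh.1.le,
        (mul_le_of_le_one_left hh.1.le hs.2).trans hh.2⟩) (N := h ^ 2 * N)
      (mul_pos (pow_pos hh.1 2) hN) (by
        rw [norm_smul, mul_pow, Real.norm_eq_abs, sq_abs]
        gcongr
        simp [N]) u (v n)
    have e1 : ∫ x in A, |∑ i, (u.grad x i - (v n).grad x i) * (h • e) i| =
        h * ∫ x in A, |∑ i, (u.grad x i - (v n).grad x i) * e i| := by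
      rw [← integral_const_mul]
      congr 1
      funext x
      rw [← abs_of_pos hh.1, ← abs_mul, abs_of_pos hh.1, Finset.mul_sum]
      congr 1
      refine Finset.sum_congr rfl fun i _ => ?_
      simp only [PiLp.smul_apply, smul_eq_mul]
      ring
    rw [e1] at key
    have hh0 := hh.1
    have h2 : h ^ 2 * N * ((hessVariation Ω u.toL1).toReal + (hessVariation Ω (v n).toL1).toReal)
        ≤ h ^ 2 * N * C := by
      gcongr
      simp only [C]
      linarith
    have h3 : h * (N * C) + 2 * ‖u.toL1 - (v n).toL1‖ / h =
        (h ^ 2 * N * C + 2 * ‖u.toL1 - (v n).toL1‖) / h := by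
      field_simp
    rw [h3, le_div_iff₀' hh.1]
    linarith
  refine tendsto_order.2 ⟨fun a ha => Eventually.of_forall fun n =>
    ha.trans_le (integral_nonneg fun _ => abs_nonneg _), fun ε hε => ?_⟩
  obtain ⟨h, hh, hhε⟩ : ∃ h ∈ Ioc 0 τ, h * (N * C) ≤ ε / 2 := by
    refine ⟨min τ (ε / 2 / (N * C)), ⟨by positivity, min_le_left _ _⟩, ?_⟩
    calc min τ (ε / 2 / (N * C)) * (N * C) ≤ ε / 2 / (N * C) * (N * C) := by
          gcongr; exact min_le_right _ _
      _ = ε / 2 := by field_simp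
  have hlim : Tendsto (fun n => 2 * ‖u.toL1 - (v n).toL1‖ / h) atTop (𝓝 0) := by
    simpa using ((tendsto_norm_sub_of_intermediateDist hv).const_mul 2).div_const h
  filter_upwards [hbound h hh, hlim.eventually (gt_mem_nhds (half_pos hε))] with n h1 h2
  linarith

/-- The directions `e₀` and `e₀ + (r/2) eᵢ`, with `eᵢ` the standard basis vectors, all lie in the
ball; subtracting their directional derivatives isolates the `i`-th partial derivative, at the cost
of a factor `2 / r`. -/
theorem tendsto_lintegral_enorm_grad_sub_of_hasInteriorCone (hΩ : IsOpen Ω)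
    (hv : Tendsto (fun n => HB.intermediateDist u (v n)) atTop (𝓝 0)) {x : Plane}
    (hx : HasInteriorCone Ω x) :
    ∃ U ∈ 𝓝 x, Tendsto (fun n => ∫⁻ y in U ∩ Ω, ‖u.grad y - (v n).grad y‖ₑ) atTop (𝓝 0) := by
  obtain ⟨U, hU, hxU, e₀, r, τ, hr, hτ, hcone⟩ := hx
  refine ⟨U, hU.mem_nhds hxU, ?_⟩
  have hA : IsOpen (U ∩ Ω) := hU.inter hΩ
  have hlim : ∀ e ∈ Metric.ball e₀ r, Tendsto (fun n => ∫ y in U ∩ Ω,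
      |∑ i, (u.grad y i - (v n).grad y i) * e i|) atTop (𝓝 0) := fun e he =>
    tendsto_integral_abs_inner_grad_sub hv hA inter_subset_right hτ (hcone e he)
  set e : Fin 2 → Plane := fun i => e₀ + EuclideanSpace.single i (r / 2)
  have he : ∀ i, e i ∈ Metric.ball e₀ r := fun i => by
    rw [mem_ball_iff_norm]
    simp only [e, add_sub_cancel_left, PiLp.norm_single]
    rw [Real.norm_of_nonneg (by positivity)]
    linarith
  have hgi : ∀ w : HB Ω, Integrable w.grad (volume.restrict (U ∩ Ω)) := fun w =>
    (L1.integrable_coeFn w.grad).mono_measure (Measure.restrict_mono inter_subset_right le_rfl)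
  have hint : ∀ n (e : Plane), Integrable (fun y => |∑ i, (u.grad y i - (v n).grad y i) * e i|)
      (volume.restrict (U ∩ Ω)) := fun n e =>
    (integrable_finsetSum _ fun i _ =>
      (((EuclideanSpace.proj (𝕜 := ℝ) i).integrable_comp (hgi u)).sub
        ((EuclideanSpace.proj (𝕜 := ℝ) i).integrable_comp (hgi (v n)))).mul_const _).abs
  have hint' : ∀ n i, Integrable (fun y => |∑ j, (u.grad y j - (v n).grad y j) * e i j| +
      |∑ j, (u.grad y j - (v n).grad y j) * e₀ j|) (volume.restrict (U ∩ Ω)) := fun n i =>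
    (hint n (e i)).add (hint n e₀)
  have hsum : Tendsto (fun n => ENNReal.ofReal (2 / r * ∑ i,
      ((∫ y in U ∩ Ω, |∑ j, (u.grad y j - (v n).grad y j) * e i j|) +
        ∫ y in U ∩ Ω, |∑ j, (u.grad y j - (v n).grad y j) * e₀ j|))) atTop (𝓝 0) := by
    rw [← ENNReal.ofReal_zero]
    refine ENNReal.tendsto_ofReal ?_
    have := (tendsto_finsetSum Finset.univ fun i _ =>
      (hlim (e i) (he i)).add (hlim e₀ (Metric.mem_ball_self hr))).const_mul (2 / r)
    simpa using this
  refine tendsto_of_tendsto_of_tendsto_of_le_of_le tendsto_const_nhds hsum (fun _ => zero_le)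
    fun n => ?_
  beta_reduce
  have hconv := ofReal_integral_norm_eq_lintegral_enorm ((hgi u).sub (hgi (v n)))
  simp only [Pi.sub_apply] at hconv
  rw [← hconv]
  refine ENNReal.ofReal_le_ofReal ?_
  have hpt : ∀ y, ‖u.grad y - (v n).grad y‖ ≤ 2 / r * ∑ i,
      (|∑ j, (u.grad y j - (v n).grad y j) * e i j| +
        |∑ j, (u.grad y j - (v n).grad y j) * e₀ j|) := by
    intro y
    have h1 : ‖u.grad y - (v n).grad y‖ ≤ ∑ i, |u.grad y i - (v n).grad y i| := by
      rw [EuclideanSpace.norm_eq, Real.sqrt_le_left (Finset.sum_nonneg fun _ _ => abs_nonneg _)]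
      simp only [Fin.sum_univ_two, PiLp.sub_apply, Real.norm_eq_abs]
      nlinarith [mul_nonneg (abs_nonneg (u.grad y 0 - (v n).grad y 0))
        (abs_nonneg (u.grad y 1 - (v n).grad y 1))]
    refine h1.trans ?_
    rw [Finset.mul_sum]
    refine Finset.sum_le_sum fun i _ => ?_
    have h2 : ∑ j, (u.grad y j - (v n).grad y j) * e i j =
        (∑ j, (u.grad y j - (v n).grad y j) * e₀ j) + (u.grad y i - (v n).grad y i) * (r / 2) := by
      simp only [e, PiLp.add_apply, mul_add, Finset.sum_add_distrib]
      congr 1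
      simp
    have h3 : |(u.grad y i - (v n).grad y i) * (r / 2)| ≤
        |∑ j, (u.grad y j - (v n).grad y j) * e i j| +
          |∑ j, (u.grad y j - (v n).grad y j) * e₀ j| := by
      rw [h2]
      have := abs_sub ((∑ j, (u.grad y j - (v n).grad y j) * e₀ j) +
        (u.grad y i - (v n).grad y i) * (r / 2)) (∑ j, (u.grad y j - (v n).grad y j) * e₀ j)
      rwa [add_sub_cancel_left] at this
    rw [abs_mul, abs_of_pos (half_pos hr)] at h3
    calc |u.grad y i - (v n).grad y i|
        = 2 / r * (|u.grad y i - (v n).grad y i| * (r / 2)) := by field_simp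
      _ ≤ _ := by gcongr
  calc ∫ y in U ∩ Ω, ‖u.grad y - (v n).grad y‖
      ≤ ∫ y in U ∩ Ω, 2 / r * ∑ i, (|∑ j, (u.grad y j - (v n).grad y j) * e i j| +
        |∑ j, (u.grad y j - (v n).grad y j) * e₀ j|) :=
        integral_mono ((hgi u).sub (hgi (v n))).norm
          ((integrable_finsetSum _ fun i _ => hint' n i).const_mul _) hpt
    _ = _ := by
        rw [integral_const_mul, integral_finsetSum _ fun i _ => hint' n i]
        congr 1
        exact Finset.sum_congr rfl fun i _ => integral_add (hint n (e i)) (hint n e₀)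

/-- Strong convergence of the gradients. -/
theorem tendsto_grad_of_intermediateDist (hΩ : IsPiecewiseC3Domain Ω)
    (hv : Tendsto (fun n => HB.intermediateDist u (v n)) atTop (𝓝 0)) :
    Tendsto (fun n => (v n).grad) atTop (𝓝 u.grad) := by
  have hK : IsCompact (closure Ω) := hΩ.isBounded.isCompact_closure
  have key : Tendsto (fun n => ∫⁻ y in closure Ω ∩ Ω, ‖u.grad y - (v n).grad y‖ₑ) atTop (𝓝 0) := by
    -- Convergence on `s ∩ Ω` passes to subsets and finite unions, so compactness of the closure
    -- reduces it to neighbourhoods of points.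
    refine hK.induction_on
      (p := fun s => Tendsto (fun n => ∫⁻ y in s ∩ Ω, ‖u.grad y - (v n).grad y‖ₑ) atTop (𝓝 0))
      (by simp) (fun s t hst ht => ?_) (fun s t hs ht => ?_) fun x hx => ?_
    · exact tendsto_of_tendsto_of_tendsto_of_le_of_le tendsto_const_nhds ht (fun _ => zero_le)
        fun n => lintegral_mono_set (inter_subset_inter_left _ hst)
    · have := hs.add ht
      rw [add_zero] at this
      refine tendsto_of_tendsto_of_tendsto_of_le_of_le tendsto_const_nhds this (fun _ => zero_le)
        fun n => ?_
      beta_reduce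
      rw [union_inter_distrib_right]
      exact lintegral_union_le _ _ _
    · obtain ⟨U, hU, h⟩ :=
        tendsto_lintegral_enorm_grad_sub_of_hasInteriorCone hΩ.isOpen hv (hΩ.hasInteriorCone hx)
      exact ⟨U, mem_nhdsWithin_of_mem_nhds hU, h⟩
  rw [inter_eq_right.2 subset_closure] at key
  rw [tendsto_iff_edist_tendsto_0]
  refine key.congr fun n => ?_
  rw [edist_comm, Lp.edist_def, eLpNorm_one_eq_lintegral_enorm]
  rfl

/-- Both integrals equal pairings of the functions with the bounded function `∂ᵢ∂ⱼψ`, so `L¹`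
convergence suffices. -/
theorem tendsto_integral_hess_of_isTestFunction
    (hv : Tendsto (fun n => HB.intermediateDist u (v n)) atTop (𝓝 0)) {ψ : Plane → ℝ}
    (hψ : IsTestFunction Ω ψ) (i j : Fin 2) :
    Tendsto (fun n => ∫ᵛ x : Ω, ψ x ∂•((v n).hess i j)) atTop
      (𝓝 (∫ᵛ x : Ω, ψ x ∂•(u.hess i j))) := by
  have hψ' := (hψ.pderiv j).pderiv i
  obtain ⟨C, hC⟩ := hψ'.exists_bound
  simp only [← (v _).hasHessianMeasure_hess ψ hψ, ← u.hasHessianMeasure_hess ψ hψ]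
  rw [tendsto_iff_norm_sub_tendsto_zero]
  have hlim := (tendsto_norm_sub_of_intermediateDist hv).const_mul C
  rw [mul_zero] at hlim
  refine squeeze_zero (fun _ => norm_nonneg _) (fun n => ?_) hlim
  have hu := L1.integrable_coeFn u.toL1
  have hn := L1.integrable_coeFn (v n).toL1
  rw [norm_sub_rev, ← integral_sub (hψ'.integrable_mul hu) (hψ'.integrable_mul hn),
    L1.norm_eq_integral_norm, ← integral_const_mul]
  refine norm_integral_le_of_norm_le ((L1.integrable_coeFn _).norm.const_mul C) ?_
  filter_upwards [Lp.coeFn_sub u.toL1 (v n).toL1] with x hx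
  have hx' : (u.toL1 - (v n).toL1 : L1 Ω ℝ) x = u.toL1 x - (v n).toL1 x := hx
  rw [← sub_mul, norm_mul, mul_comm]
  refine mul_le_mul (hC x) (le_of_eq ?_) (norm_nonneg _) ((norm_nonneg _).trans (hC x))
  exact congrArg norm hx'.symm

end Convergence

/-! ### Weak-* convergence of the measures -/

theorem exists_isTestFunction_abs_sub_zeroAtInfty_le {Ω : Set Plane} (hΩ : IsOpen Ω) (ψ : C₀(Ω, ℝ))
    {ε : ℝ} (hε : 0 < ε) : ∃ η, IsTestFunction Ω η ∧ ∀ x : Ω, |η x - ψ x| ≤ ε := by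
  have hψ : Continuous ψ := ψ.continuous
  -- Soft thresholding at level `ε / 2`: a continuous function within `ε / 2` of `ψ` that vanishes
  -- where `|ψ| < ε / 2`, hence outside a compact set.
  set f : Ω → ℝ := fun x => max (ψ x - ε / 2) 0 + min (ψ x + ε / 2) 0
  have hf : Continuous f := by fun_prop
  have hs : HasCompactSupport f := by
    have h := ψ.zero_at_infty'.eventually (Metric.ball_mem_nhds 0 (half_pos hε))
    obtain ⟨K, hK, hKs⟩ := mem_cocompact.1 h
    refine HasCompactSupport.intro hK fun x hx => ?_
    have h1 : |ψ x| < ε / 2 := by simpa using hKs hx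
    rw [abs_lt] at h1
    simp only [f]
    rw [max_eq_right (by linarith [h1.2]), min_eq_right (by linarith [h1.1]), add_zero]
  obtain ⟨η, h1, h2, -⟩ := exists_isTestFunction_abs_sub_lt hΩ hf hs (half_pos hε)
  refine ⟨η, h1, fun x => ?_⟩
  have h3 : |f x - ψ x| ≤ ε / 2 := by
    simp only [f]
    rw [abs_le]
    rcases max_cases (ψ x - ε / 2) 0 with h | h <;> rcases min_cases (ψ x + ε / 2) 0 with h' | h' <;>
      constructor <;> linarith [h.1, h.2, h'.1, h'.2]
  have := abs_sub_le (η x) (f x) (ψ x)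
  linarith [h2 x]

instance {X : Type*} [MeasurableSpace X] (μ : SignedMeasure X) : IsFiniteMeasure μ.variation := by
  rw [← SignedMeasure.totalVariation_eq_variation]
  unfold SignedMeasure.totalVariation
  infer_instance

theorem abs_integral_signedMeasure_le {X : Type*} [MeasurableSpace X] (μ : SignedMeasure X)
    {f : X → ℝ} {c : ℝ} (hf : ∀ x, |f x| ≤ c) :
    |∫ᵛ x, f x ∂•μ| ≤ c * μ.variation.real univ := by
  have := VectorMeasure.norm_integral_le_of_norm_le_const (μ := μ)
    (B := ContinuousLinearMap.lsmul ℝ ℝ) (ae_of_all _ hf)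
  simpa using this

/-- The estimate of `∫ (ψ - η) dD²w` by the total variation of `D²w`, for test functions `η`. -/
theorem abs_integral_hess_sub_le {Ω : Set Plane} (hΩ : IsOpen Ω) (w : HB Ω) (ψ : C₀(Ω, ℝ))
    {η : Plane → ℝ} (hη : IsTestFunction Ω η) {ε : ℝ} (hε : 0 < ε)
    (hηψ : ∀ x : Ω, |η x - ψ x| ≤ ε) (i j : Fin 2) :
    |(∫ᵛ x, ψ x ∂•(w.hess i j)) - ∫ᵛ x : Ω, η x ∂•(w.hess i j)| ≤
      ε * (hessVariation Ω w.toL1).toReal := by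
  set V := (hessVariation Ω w.toL1).toReal
  set M := (w.hess i j).variation.real univ
  have hV : 0 ≤ V := ENNReal.toReal_nonneg
  have hM : 0 ≤ M := measureReal_nonneg
  refine le_of_forall_pos_le_add fun δ hδ => ?_
  set κ := δ / (V + M + 1)
  have hκ : 0 < κ := by positivity
  have hκδ : κ * (V + M) ≤ δ := by
    rw [div_mul_eq_mul_div, div_le_iff₀ (by positivity)]
    nlinarith
  -- The bound by `V` holds only for test functions, and `ψ - η` need not be one. A test function
  -- `ζ` much closer to `ψ` is interposed: `ζ - η` is bounded through `V`, and `ψ - ζ` through the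
  -- variation `M` of the component. Since `w` is fixed, `κ` may depend on `M`, which disappears as
  -- `δ → 0`.
  obtain ⟨ζ, hζ, hζψ⟩ := exists_isTestFunction_abs_sub_zeroAtInfty_le hΩ ψ hκ
  have hti : ∀ {θ : Plane → ℝ}, IsTestFunction Ω θ →
      (w.hess i j).Integrable fun x : Ω => θ x := by
    intro θ hθ
    obtain ⟨C, hC⟩ := hθ.exists_bound
    have := hθ.1.continuous
    exact Integrable.of_bound (C := C) (Continuous.aestronglyMeasurable (by fun_prop))
      (ae_of_all _ fun x => hC x)
  have hψi : (w.hess i j).Integrable ψ :=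
    Integrable.of_bound (C := ‖ψ.toBCF‖) ψ.continuous.aestronglyMeasurable
      (ae_of_all _ fun x => ψ.toBCF.norm_coe_le_norm x)
  have h1 : |(∫ᵛ x, ψ x ∂•(w.hess i j)) - ∫ᵛ x : Ω, ζ x ∂•(w.hess i j)| ≤ κ * M := by
    rw [← VectorMeasure.integral_fun_sub hψi (hti hζ)]
    refine abs_integral_signedMeasure_le _ fun x => ?_
    rw [abs_sub_comm]
    exact hζψ x
  have h2 : |(∫ᵛ x : Ω, ζ x ∂•(w.hess i j)) - ∫ᵛ x : Ω, η x ∂•(w.hess i j)| ≤ (κ + ε) * V := by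
    have hζη : IsTestFunction Ω fun x => ζ x - η x :=
      ⟨hζ.1.sub hη.1, hζ.2.1.sub hη.2.1,
        (tsupport_sub _ _).trans (union_subset hζ.2.2 hη.2.2)⟩
    rw [← VectorMeasure.integral_fun_sub (hti hζ) (hti hη),
      ← w.hasHessianMeasure_hess _ hζη]
    refine abs_integral_mul_pderiv_pderiv_le w.hessVariation_ne_top hζη (by positivity)
      (fun x hx => ?_) i j
    have h3 := hζψ ⟨x, hx⟩
    have h4 := hηψ ⟨x, hx⟩
    rw [abs_sub_comm] at h4
    exact (abs_sub_le _ (ψ ⟨x, hx⟩) _).trans (add_le_add h3 h4)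
  have := abs_sub_le (∫ᵛ x, ψ x ∂•(w.hess i j)) (∫ᵛ x : Ω, ζ x ∂•(w.hess i j))
    (∫ᵛ x : Ω, η x ∂•(w.hess i j))
  nlinarith

/-- Replacing `ψ` by one test function `η` costs an error uniform in large `n`, because the
variations are eventually at most `V + 1`. -/
theorem tendsto_integral_hess_zeroAtInfty {Ω : Set Plane} (hΩ : IsOpen Ω) {u : HB Ω}
    {v : ℕ → HB Ω} (hv : Tendsto (fun n => HB.intermediateDist u (v n)) atTop (𝓝 0)) (i j : Fin 2)
    (ψ : C₀(Ω, ℝ)) :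
    Tendsto (fun n => ∫ᵛ x, ψ x ∂•((v n).hess i j)) atTop
      (𝓝 (∫ᵛ x, ψ x ∂•(u.hess i j))) := by
  set V := (hessVariation Ω u.toL1).toReal
  have hV : 0 ≤ V := ENNReal.toReal_nonneg
  rw [Metric.tendsto_nhds]
  intro ε hε
  -- The two replacement errors are at most `κ V` and `κ (V + 1)`, together below `ε / 2`.
  set κ := ε / 2 / (2 * V + 2)
  have hκ : 0 < κ := by positivity
  have hκε : κ * (2 * V + 2) = ε / 2 := by
    simp only [κ]
    field_simp
  obtain ⟨η, hη, hηψ⟩ := exists_isTestFunction_abs_sub_zeroAtInfty_le hΩ ψ hκ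
  filter_upwards [eventually_hessVariation_le_of_intermediateDist hv,
    Metric.tendsto_nhds.1 (tendsto_integral_hess_of_isTestFunction hv hη i j) (ε / 2)
      (half_pos hε)] with n h1 h2
  have h3 := abs_integral_hess_sub_le hΩ (v n) ψ hη hκ hηψ i j
  have h4 := abs_integral_hess_sub_le hΩ u ψ hη hκ hηψ i j
  have h5 : κ * (hessVariation Ω (v n).toL1).toReal ≤ κ * (V + 1) := by gcongr
  rw [Real.dist_eq] at *
  rw [abs_le] at h3 h4
  rw [abs_lt] at *
  constructor <;> linarith [h2.1, h2.2, h3.1, h3.2, h4.1, h4.2]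

end BoundedHessian

theorem mainTheorem8 (Ω : Set BoundedHessian.Plane) (hΩ : BoundedHessian.IsPiecewiseC3Domain Ω)
    (u : BoundedHessian.HB Ω) (v : ℕ → BoundedHessian.HB Ω)
    (hv : Tendsto (fun n => BoundedHessian.HB.intermediateDist u (v n)) atTop (𝓝 0)) :
    Tendsto v atTop (@nhds (BoundedHessian.HB Ω) (BoundedHessian.HB.weakTopology Ω) u) ∧
    Tendsto (fun n => (v n).grad) atTop (𝓝 u.grad) ∧
    ∀ (i j : Fin 2) (ψ : C₀(Ω, ℝ)),
      Tendsto (fun n => ∫ᵛ x, ψ x ∂•((v n).hess i j)) atTop (𝓝 (∫ᵛ x, ψ x ∂•(u.hess i j))) := by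
  have hgrad := BoundedHessian.tendsto_grad_of_intermediateDist hΩ hv
  refine ⟨?_, hgrad, BoundedHessian.tendsto_integral_hess_zeroAtInfty hΩ.isOpen hv⟩
  -- The weak topology is induced from a product, so convergence is checked component by component.
  rw [nhds_induced, tendsto_comap_iff]
  exact (BoundedHessian.tendsto_toL1_of_intermediateDist hv).prodMk_nhds
    (hgrad.prodMk_nhds (tendsto_pi_nhds.2 fun p =>
      BoundedHessian.tendsto_integral_hess_of_isTestFunction hv p.1.2 p.2.1 p.2.2))
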